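/- Let $(R,\mathfrak m)$ be a one-dimensional analytically irreducible local domain with quotient field $Q(R)$, that is, a one-dimensional Noetherian local domain whose integral closure $\overline R$ in $Q(R)$ is a discrete valuation ring and a finite $R$-module. Assume that $R$ is Gorenstein. For a nonzero fractional ideal $I$ put $I^{-1}=\{f\in Q(R) : fI\subseteq R\}$, and let $C=\{f\in Q(R): f\overline R\subseteq R\}$ be the conductor of $R$. An ideal of $R$ is called a trace ideal if it is of the form $\operatorname{tr}(M)=\sum_{\varphi\in\operatorname{Hom}_R(M,R)}\varphi(M)$ for some finitely generated $R$-module $M$. Let $\mathcal T_R$ be the set of nonzero trace ideals of $R$ (so $R\in\mathcal T_R$), and for an ideal $I$ of $R$ let $\operatorname{subtr}(I)$ be the largest trace ideal contained in $I$, which is the sum of all trace ideals contained in $I$. For $I,J\in\mathcal T_R$ put $I*J=(I^{-1}J^{-1})^{-1}$, and note that this expression also makes sense for $J=C$. Then for all $I,J\in\mathcal T_R$: (a) $I*J\in\mathcal T_R$. (b) $I*J=J*I$, $R*I=I*I=I$ and $I*C=C$. (c) $I*J=\operatorname{subtr}(I\cap J)\subseteq I\cap J$; that is, $I*J$ is the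 largest trace ideal contained in $I\cap J$. In particular, $I\cap J$ is a trace ideal if and only if $I\cap J=I*J$. -/

import Mathlib

open scoped nonZeroDivisors

universe u v

/-- A Noetherian local ring is Gorenstein if it has finite injective dimension as a module
over itself. -/
def IsGorensteinLocal (R : Type u) [CommRing R] [IsLocalRing R] [IsNoetherianRing R] : Prop :=
  ∃ n : ℕ, CategoryTheory.HasInjectiveDimensionLE (ModuleCat.of R R) n

/-- A one-dimensional analytically irreducible local domain: a one-dimensional Noetherian local
domain `R` with quotient field `K` such that the integral closure of `R` in `K` is a discrete
valuation ring and a finite `R`-module. -/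
structure IsOneDimAnalyticallyIrreducible (R : Type u) (K : Type v) [CommRing R] [IsDomain R]
    [IsLocalRing R] [IsNoetherianRing R] [Field K] [Algebra R K] [IsFractionRing R K] :
    Prop where
  dim_eq_one : ringKrullDim R = 1
  integralClosure_dvr : IsDiscreteValuationRing (integralClosure R K)
  integralClosure_finite : Module.Finite R (integralClosure R K)

/-- The trace of a module `M`: the sum of the ideals `φ(M)`, where `φ` runs over `Hom_R(M, R)`. -/
def moduleTrace (R : Type u) [CommRing R] (M : Type v) [AddCommGroup M] [Module R M] : Ideal R :=
  ⨆ φ : M →ₗ[R] R, LinearMap.range φ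

/-- An ideal is a trace ideal if it is the trace of a finitely generated module. -/
def IsTraceIdeal {R : Type u} [CommRing R] (I : Ideal R) : Prop :=
  ∃ (M : Type u) (_ : AddCommGroup M) (_ : Module R M),
    Module.Finite R M ∧ I = moduleTrace R M

section Fractional

variable (R : Type u) (K : Type v) [CommRing R] [IsDomain R] [Field K] [Algebra R K]
  [IsFractionRing R K]

/-- The set of nonzero fractional ideals that are trace ideals of `R`. -/
def traceIdeals : Set (FractionalIdeal R⁰ K) :=
  {I | I ≠ 0 ∧ ∃ a : Ideal R, IsTraceIdeal a ∧ (a : FractionalIdeal R⁰ K) = I}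

theorem one_div_integralClosure_le_one :
    (1 : Submodule R K) / Subalgebra.toSubmodule (integralClosure R K) ≤ 1 := by
  intro x hx
  have h := Submodule.mem_div_iff_forall_mul_mem.mp hx 1 (one_mem (integralClosure R K))
  rwa [mul_one] at h

/-- The conductor `C = R : R̄ = {x ∈ K | x R̄ ⊆ R}`, where `R̄` is the integral closure of `R`
in `K`. -/
noncomputable def conductorIdeal : FractionalIdeal R⁰ K :=
  ⟨(1 : Submodule R K) / Subalgebra.toSubmodule (integralClosure R K),
    FractionalIdeal.isFractional_of_le_one _ (one_div_integralClosure_le_one R K)⟩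

variable {R K}

/-- The product `I * J = (I⁻¹ J⁻¹)⁻¹`. For a nonzero fractional ideal `I`, the fractional ideal
`I⁻¹` is `{f ∈ K | f I ⊆ R}`. -/
noncomputable def starMul (I J : FractionalIdeal R⁰ K) : FractionalIdeal R⁰ K :=
  (I⁻¹ * J⁻¹)⁻¹

/-- The sum of all trace ideals of `R` (including the zero ideal) contained in `I`. -/
noncomputable def subtr (I : FractionalIdeal R⁰ K) : FractionalIdeal R⁰ K :=
  ((sSup {a : Ideal R | IsTraceIdeal a ∧ (a : FractionalIdeal R⁰ K) ≤ I} : Ideal R) :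
    FractionalIdeal R⁰ K)

end Fractional

/-!
A nonzero ideal `I` is a trace ideal exactly when `I I⁻¹ = I`. Then `I⁻¹ = (I I⁻¹)⁻¹` is the
endomorphism ring `I : I`, a finite overring of `R` inside the integral closure; conversely the
inverse of every finite overring is a trace ideal. On reflexive ideals `I ↦ I⁻¹` reverses
inclusions, and `I⁻¹ J⁻¹` is the smallest overring containing both `I⁻¹` and `J⁻¹`, so that its
inverse `I * J` is the largest trace ideal contained in `I ∩ J`.

Reflexivity is where Gorensteinness enters. A nonzero finite length module `R / x` contains the
residue field and has no `Ext` into `R` beyond degree one, so descending dimension shifting from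
the injective dimension of `R` gives `Ext²(T, R) = 0` for all `T` of finite length, hence
`Ext¹(b, R) = 0` for every nonzero ideal `b`. If `a ⊊ b`, a nonzero map `b / a → R / x` therefore
lifts to a linear form on `b`, which is multiplication by some `q`, and `q / x` lies in `a⁻¹` but
not in `b⁻¹`.
-/

open CategoryTheory CategoryTheory.Abelian IsLocalRing FractionalIdeal

section Ext

universe w

variable {C : Type u} [Category.{v} C] [Abelian C] [HasExt.{w} C] {S : ShortComplex C} {X Y : C}
  {i : ℕ}

theorem subsingleton_ext_X₁ (hS : S.ShortExact) (h₂ : Subsingleton (Ext S.X₂ Y i))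
    (h₃ : Subsingleton (Ext S.X₃ Y (i + 1))) : Subsingleton (Ext S.X₁ Y i) := by
  refine subsingleton_of_forall_eq 0 fun e => ?_
  obtain ⟨e', rfl⟩ := Ext.contravariant_sequence_exact₁ hS Y e (add_comm 1 i)
    (Subsingleton.elim _ _)
  rw [Subsingleton.elim e' 0, Ext.comp_zero]

theorem subsingleton_ext_X₂ (hS : S.ShortExact) (h₁ : Subsingleton (Ext S.X₁ Y i))
    (h₃ : Subsingleton (Ext S.X₃ Y i)) : Subsingleton (Ext S.X₂ Y i) := by
  refine subsingleton_of_forall_eq 0 fun e => ?_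
  obtain ⟨e', rfl⟩ := Ext.contravariant_sequence_exact₂ hS Y e (Subsingleton.elim _ _)
  rw [Subsingleton.elim e' 0, Ext.comp_zero]

theorem subsingleton_ext_X₃ (hS : S.ShortExact) (h₁ : Subsingleton (Ext S.X₁ Y i))
    (h₂ : Subsingleton (Ext S.X₂ Y (i + 1))) : Subsingleton (Ext S.X₃ Y (i + 1)) := by
  refine subsingleton_of_forall_eq 0 fun e => ?_
  obtain ⟨e', rfl⟩ := Ext.contravariant_sequence_exact₃ hS Y e (Subsingleton.elim _ _)
    (add_comm 1 i)
  rw [Subsingleton.elim e' 0, Ext.comp_zero]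

theorem exists_comp_eq_of_subsingleton_ext_one (hS : S.ShortExact)
    (h : Subsingleton (Ext X S.X₁ 1)) (φ : X ⟶ S.X₃) : ∃ ψ : X ⟶ S.X₂, ψ ≫ S.g = φ := by
  obtain ⟨e, he⟩ := Ext.covariant_sequence_exact₃ X hS (Ext.mk₀ φ) (zero_add 1)
    (Subsingleton.elim _ _)
  obtain ⟨ψ, rfl⟩ := (Ext.mk₀_bijective X S.X₂).surjective e
  rw [Ext.mk₀_comp_mk₀] at he
  exact ⟨ψ, (Ext.mk₀_bijective X S.X₃).injective he⟩

end Ext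

section FiniteLength

section

variable {R : Type u} [Ring R] {M N : Type v} [AddCommGroup M] [Module R M] [AddCommGroup N]
  [Module R N]

theorem shortExact_subtype_mkQ (P : Submodule R M) :
    (ModuleCat.shortComplexOfCompEqZero P.subtype P.mkQ
      (LinearMap.exact_subtype_mkQ P).linearMap_comp_eq_zero).ShortExact :=
  ModuleCat.shortComplex_shortExact _ (LinearMap.exact_subtype_mkQ P) P.injective_subtype
    P.mkQ_surjective

theorem shortExact_mkQ_range {f : M →ₗ[R] N} (hf : Function.Injective f) :
    (ModuleCat.shortComplexOfCompEqZero f (LinearMap.range f).mkQ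
      f.exact_map_mkQ_range.linearMap_comp_eq_zero).ShortExact :=
  ModuleCat.shortComplex_shortExact _ f.exact_map_mkQ_range hf (Submodule.mkQ_surjective _)

theorem subsingleton_ext_of_isFiniteLength [Small.{v} R] {Y : ModuleCat.{v} R} {i : ℕ}
    (h : ∀ (S : Type v) [AddCommGroup S] [Module R S] [IsSimpleModule R S],
      Subsingleton (Ext (ModuleCat.of R S) Y i)) (hM : IsFiniteLength R M) :
    Subsingleton (Ext (ModuleCat.of R M) Y i) := by
  induction hM with
  | @of_subsingleton M _ _ _ =>
    have hM := ModuleCat.isZero_of_subsingleton (ModuleCat.of R M)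
    refine subsingleton_of_forall_eq 0 fun e => ?_
    rw [← e.mk₀_id_comp, hM.eq_zero_of_src (𝟙 _), Ext.mk₀_zero, Ext.zero_comp]
  | @of_simple_quotient M _ _ P _ _ ih =>
    exact subsingleton_ext_X₂ (shortExact_subtype_mkQ P) ih (h (M ⧸ P))

end

variable {R : Type u} [CommRing R] [IsLocalRing R]

theorem exists_injective_of_isSimpleModule (S M : Type*) [AddCommGroup S] [Module R S]
    [IsSimpleModule R S] [AddCommGroup M] [Module R M] [IsArtinian R M] [Nontrivial M] :
    ∃ f : S →ₗ[R] M, Function.Injective f := by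
  obtain ⟨N, hN⟩ := IsAtomic.exists_atom (Submodule R M)
  have := isSimpleModule_iff_isAtom.mpr hN
  obtain ⟨m, hm, ⟨e⟩⟩ := isSimpleModule_iff_quot_maximal.mp ‹IsSimpleModule R S›
  obtain ⟨m', hm', ⟨e'⟩⟩ := isSimpleModule_iff_quot_maximal.mp ‹IsSimpleModule R N›
  obtain rfl : m = m' := (eq_maximalIdeal hm).trans (eq_maximalIdeal hm').symm
  exact ⟨N.subtype ∘ₗ (e.trans e'.symm).toLinearMap,
    N.injective_subtype.comp (e.trans e'.symm).injective⟩

theorem exists_linearMap_ne_zero_of_le_ker (Q : Type*) {M : Type*} [AddCommGroup M] [Module R M]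
    [Module.Finite R M] [AddCommGroup Q] [Module R Q] [IsArtinian R Q] [Nontrivial Q]
    {N : Submodule R M} (hN : N ≠ ⊤) : ∃ φ : M →ₗ[R] Q, φ ≠ 0 ∧ N ≤ LinearMap.ker φ := by
  obtain ⟨P, hP, hNP⟩ := (eq_top_or_exists_le_coatom N).resolve_left hN
  have := isSimpleModule_iff_isCoatom.mpr hP
  obtain ⟨f, hf⟩ := exists_injective_of_isSimpleModule (R := R) (M ⧸ P) Q
  have hker : LinearMap.ker (f ∘ₗ P.mkQ) = P := by
    rw [LinearMap.ker_comp_of_ker_eq_bot _ (LinearMap.ker_eq_bot.mpr hf), P.ker_mkQ]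
  refine ⟨f ∘ₗ P.mkQ, fun h => hP.ne_top ?_, hNP.trans hker.ge⟩
  rw [← hker, h, LinearMap.ker_zero]

theorem subsingleton_ext_of_isFiniteLength_of_le [Small.{v} R] {Y : ModuleCat.{v} R} {n d : ℕ}
    [HasInjectiveDimensionLT Y n] {Q : Type v} [AddCommGroup Q] [Module R Q] [Nontrivial Q]
    (hQ : IsFiniteLength R Q) (hQY : ∀ i, d ≤ i → Subsingleton (Ext (ModuleCat.of R Q) Y i))
    {T : Type v} [AddCommGroup T] [Module R T] (hT : IsFiniteLength R T) {i : ℕ} (hi : d ≤ i) :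
    Subsingleton (Ext (ModuleCat.of R T) Y i) := by
  obtain ⟨_, _⟩ := isFiniteLength_iff_isNoetherian_isArtinian.mp hQ
  -- Descending induction on `i`, starting at the injective dimension of `Y`.
  obtain ⟨k, hk⟩ : ∃ k, n ≤ i + k := ⟨n, by lia⟩
  induction k generalizing i T with
  | zero => exact HasInjectiveDimensionLT.subsingleton Y n i hk _
  | succ k ih =>
    refine subsingleton_ext_of_isFiniteLength (fun S _ _ _ => ?_) hT
    obtain ⟨f, hf⟩ := exists_injective_of_isSimpleModule (R := R) S Q
    exact subsingleton_ext_X₁ (shortExact_mkQ_range hf) (hQY i hi)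
      (ih (hQ.of_surjective (LinearMap.range f).mkQ_surjective) (by lia) (by lia))

end FiniteLength

section Gorenstein

open scoped Pointwise

section

variable {R : Type u} [CommRing R] {x : R}

theorem exists_mkQ_comp_eq_of_subsingleton_ext_one {M N : Type u} [AddCommGroup M] [Module R M]
    [AddCommGroup N] [Module R N] (hx : IsSMulRegular N x)
    (h : Subsingleton (Ext (ModuleCat.of R M) (ModuleCat.of R N) 1))
    (φ : M →ₗ[R] QuotSMulTop x N) :
    ∃ ψ : M →ₗ[R] N, (x • (⊤ : Submodule R N)).mkQ ∘ₗ ψ = φ := by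
  obtain ⟨ψ, hψ⟩ := exists_comp_eq_of_subsingleton_ext_one
    (hx.smulShortComplex_shortExact (M := ModuleCat.of R N)) h (ModuleCat.ofHom φ)
  exact ⟨ψ.hom, congrArg ModuleCat.Hom.hom hψ⟩

theorem subsingleton_ext_quotSMulTop (hx : IsSMulRegular R x) (Y : ModuleCat.{u} R) (i : ℕ) :
    Subsingleton (Ext (ModuleCat.of R (QuotSMulTop x R)) Y (i + 2)) :=
  subsingleton_ext_X₃ (hx.smulShortComplex_shortExact (M := ModuleCat.of R R))
    (Ext.subsingleton_of_projective (ModuleCat.of R R) Y i)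
    (Ext.subsingleton_of_projective (ModuleCat.of R R) Y (i + 1))

theorem isFiniteLength_quotSMulTop [IsNoetherianRing R] [Ring.KrullDimLE 1 R] (hx : x ∈ R⁰) :
    IsFiniteLength R (QuotSMulTop x R) := by
  have hspan : Ideal.span {x} = x • (⊤ : Submodule R R) := by
    rw [← Submodule.ideal_span_singleton_smul, smul_eq_mul, Ideal.mul_top]
  exact (Submodule.quotEquivOfEq _ _ hspan).isFiniteLength
    (isFiniteLength_quotient_span_singleton R hx)

end

variable {R : Type u} [CommRing R] [IsDomain R] [IsLocalRing R] [IsNoetherianRing R]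
  [Ring.KrullDimLE 1 R]

theorem subsingleton_ext_two_of_isGorensteinLocal (hG : IsGorensteinLocal R) (hF : ¬ IsField R)
    {T : Type u} [AddCommGroup T] [Module R T] (hT : IsFiniteLength R T) :
    Subsingleton (Ext (ModuleCat.of R T) (ModuleCat.of R R) 2) := by
  obtain ⟨n, hn⟩ := hG
  obtain ⟨x, hxm, hx⟩ := Submodule.exists_mem_ne_zero_of_ne_bot
    (mt isField_iff_maximalIdeal_eq.mpr hF)
  have := nontrivial_quotSMulTop_of_mem_maximalIdeal R hxm
  refine subsingleton_ext_of_isFiniteLength_of_le (n := n + 1)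
    (isFiniteLength_quotSMulTop (mem_nonZeroDivisors_of_ne_zero hx)) (fun i hi => ?_) hT le_rfl
  obtain ⟨i, rfl⟩ := Nat.exists_eq_add_of_le' hi
  exact subsingleton_ext_quotSMulTop (IsSMulRegular.of_ne_zero hx) _ i

theorem subsingleton_ext_one_ideal (hG : IsGorensteinLocal R) (hF : ¬ IsField R) {b : Ideal R}
    (hb : b ≠ ⊥) : Subsingleton (Ext (ModuleCat.of R b) (ModuleCat.of R R) 1) := by
  obtain ⟨x, hxb, hx⟩ := Submodule.exists_mem_ne_zero_of_ne_bot hb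
  have hfl : IsFiniteLength R (R ⧸ b) :=
    (isFiniteLength_quotient_span_singleton R (mem_nonZeroDivisors_of_ne_zero hx)).of_surjective
      (Submodule.factor_surjective ((Ideal.span_singleton_le_iff_mem b).mpr hxb))
  exact subsingleton_ext_X₁ (shortExact_subtype_mkQ b)
    (Ext.subsingleton_of_projective (ModuleCat.of R R) _ 0)
    (subsingleton_ext_two_of_isGorensteinLocal hG hF hfl)

theorem exists_linearMap_forall_dvd_of_lt (hG : IsGorensteinLocal R) {a b : Ideal R}
    (ha : a ≠ ⊥) (hab : a < b) :
    ∃ x : R, x ≠ 0 ∧ ∃ ψ : b →ₗ[R] R, (∀ w, w.1 ∈ a → x ∣ ψ w) ∧ ∃ w, ¬ x ∣ ψ w := by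
  obtain ⟨x, hxa, hx⟩ := Submodule.exists_mem_ne_zero_of_ne_bot ha
  have hF : ¬ IsField R := Ring.not_isField_iff_exists_ideal_bot_lt_and_lt_top.mpr
    ⟨a, bot_lt_iff_ne_bot.mpr ha, hab.trans_le le_top⟩
  have := nontrivial_quotSMulTop_of_mem_maximalIdeal R (le_maximalIdeal hab.ne_top hxa)
  obtain ⟨_, _⟩ := isFiniteLength_iff_isNoetherian_isArtinian.mp
    (isFiniteLength_quotSMulTop (mem_nonZeroDivisors_of_ne_zero hx))
  have hN : a.submoduleOf b ≠ ⊤ := fun h => hab.not_ge (Submodule.submoduleOf_eq_top.mp h)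
  obtain ⟨φ, hφ, hNφ⟩ := exists_linearMap_ne_zero_of_le_ker (QuotSMulTop x R) hN
  obtain ⟨ψ, rfl⟩ := exists_mkQ_comp_eq_of_subsingleton_ext_one (IsSMulRegular.of_ne_zero hx)
    (subsingleton_ext_one_ideal hG hF hab.ne_bot) φ
  have hdvd (w : b) : x ∣ ψ w ↔ (x • (⊤ : Submodule R R)).mkQ (ψ w) = 0 := by
    rw [Submodule.mkQ_apply, Submodule.Quotient.mk_eq_zero,
      Submodule.mem_smul_pointwise_iff_exists]
    simp [dvd_def, eq_comm]
  refine ⟨x, hx, ψ, fun w hw => (hdvd w).mpr (hNφ hw), ?_⟩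
  by_contra! h
  exact hφ (LinearMap.ext fun w => (hdvd w).mp (h w))

end Gorenstein

section FractionalIdeals

theorem fractionalIdeal_ne_zero_of_one_le {R K : Type*} [CommRing R] [Field K] [Algebra R K]
    {I : FractionalIdeal R⁰ K} (hI : 1 ≤ I) : I ≠ 0 :=
  (zero_lt_one.trans_le hI).ne'

theorem exists_eq_mul_of_linearMap {R : Type*} (K : Type*) [CommRing R] [Field K] [Algebra R K]
    [IsFractionRing R K] {a : Ideal R} (ha : a ≠ ⊥) (φ : a →ₗ[R] R) :
    ∃ q : K, ∀ w : a, algebraMap R K (φ w) = q * algebraMap R K w := by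
  obtain ⟨z, hz, hz0⟩ := Submodule.exists_mem_ne_zero_of_ne_bot ha
  have hz' : algebraMap R K z ≠ 0 := by simpa using hz0
  refine ⟨algebraMap R K (φ ⟨z, hz⟩) / algebraMap R K z, fun w => ?_⟩
  have hcomm : z * φ w = w * φ ⟨z, hz⟩ := by
    simp only [← smul_eq_mul, ← map_smul]
    exact congrArg φ (Subtype.ext (mul_comm _ _))
  rw [div_mul_eq_mul_div, eq_div_iff hz', ← map_mul, ← map_mul, mul_comm (φ w), hcomm, mul_comm]

variable {R : Type u} {K : Type v} [CommRing R] [IsDomain R] [Field K] [Algebra R K]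
  [IsFractionRing R K] {I J : FractionalIdeal R⁰ K}

theorem fractionalIdeal_le_inv_iff (hJ : J ≠ 0) : I ≤ J⁻¹ ↔ I * J ≤ 1 := by
  rw [FractionalIdeal.inv_eq, le_div_iff_mul_le hJ]

theorem fractionalIdeal_mul_inv_le_one (I : FractionalIdeal R⁰ K) : I * I⁻¹ ≤ 1 :=
  mul_one_div_le_one

theorem fractionalIdeal_inv_ne_zero (hI : I ≠ 0) : I⁻¹ ≠ 0 := fun h => by
  simpa [h] using bot_lt_mul_inv hI

theorem fractionalIdeal_le_inv_inv (hI : I ≠ 0) : I ≤ I⁻¹⁻¹ :=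
  (fractionalIdeal_le_inv_iff (fractionalIdeal_inv_ne_zero hI)).mpr
    (fractionalIdeal_mul_inv_le_one I)

theorem fractionalIdeal_inv_inv_inv (hI : I ≠ 0) : I⁻¹⁻¹⁻¹ = I⁻¹ :=
  le_antisymm
    (inv_anti_mono hI (fractionalIdeal_inv_ne_zero (fractionalIdeal_inv_ne_zero hI))
      (fractionalIdeal_le_inv_inv hI))
    (fractionalIdeal_le_inv_inv (fractionalIdeal_inv_ne_zero hI))

theorem fractionalIdeal_inv_le_one (hI : 1 ≤ I) : I⁻¹ ≤ 1 :=
  (le_mul_of_one_le_left' hI).trans (fractionalIdeal_mul_inv_le_one I)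

theorem coeIdeal_inv_not_le_of_lt [IsLocalRing R] [IsNoetherianRing R] [Ring.KrullDimLE 1 R]
    (hG : IsGorensteinLocal R) {a b : Ideal R} (ha : a ≠ ⊥) (hab : a < b) :
    ¬ (a : FractionalIdeal R⁰ K)⁻¹ ≤ (b : FractionalIdeal R⁰ K)⁻¹ := by
  intro hle
  obtain ⟨x, hx, ψ, hψ, w, hw⟩ := exists_linearMap_forall_dvd_of_lt hG ha hab
  obtain ⟨q, hq⟩ := exists_eq_mul_of_linearMap K hab.ne_bot ψ
  have hx' : algebraMap R K x ≠ 0 := by simpa using hx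
  have hqx : q / algebraMap R K x ∈ (a : FractionalIdeal R⁰ K)⁻¹ := by
    rw [mem_inv_iff (coeIdeal_ne_zero.mpr ha)]
    intro y hy
    obtain ⟨u, hu, rfl⟩ := (mem_coeIdeal R⁰).mp hy
    obtain ⟨r, hr⟩ := hψ ⟨u, hab.le hu⟩ hu
    refine (mem_one_iff R⁰).mpr ⟨r, ?_⟩
    rw [div_mul_eq_mul_div, eq_div_iff hx', ← hq ⟨u, hab.le hu⟩, hr, map_mul, mul_comm]
  obtain ⟨r, hr⟩ := (mem_one_iff R⁰).mp <| (mem_inv_iff (coeIdeal_ne_zero.mpr hab.ne_bot)).mp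
    (hle hqx) _ (mem_coeIdeal_of_mem R⁰ w.2)
  refine hw ⟨r, IsFractionRing.injective R K ?_⟩
  rw [map_mul, hr, hq, ← mul_assoc, mul_div_cancel₀ _ hx']

theorem coeIdeal_inv_inv_of_isGorensteinLocal [IsLocalRing R] [IsNoetherianRing R]
    [Ring.KrullDimLE 1 R] (hG : IsGorensteinLocal R) {a : Ideal R} (ha : a ≠ ⊥) :
    (a : FractionalIdeal R⁰ K)⁻¹⁻¹ = a := by
  have ha' : (a : FractionalIdeal R⁰ K) ≠ 0 := coeIdeal_ne_zero.mpr ha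
  have hinv : (1 : FractionalIdeal R⁰ K) ≤ (a : FractionalIdeal R⁰ K)⁻¹ := by
    rw [fractionalIdeal_le_inv_iff ha', one_mul]
    exact coeIdeal_le_one
  obtain ⟨b, hb⟩ := le_one_iff_exists_coeIdeal.mp (fractionalIdeal_inv_le_one hinv)
  have hab : a ≤ b := (coeIdeal_le_coeIdeal K).mp (hb ▸ fractionalIdeal_le_inv_inv ha')
  rw [← hb]
  refine congrArg _ (hab.eq_of_not_lt fun hlt => ?_).symm
  refine coeIdeal_inv_not_le_of_lt (K := K) hG ha hlt ?_
  rw [hb, fractionalIdeal_inv_inv_inv ha']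

end FractionalIdeals

section TraceIdeals

theorem le_one_of_mem_traceIdeals {R : Type u} {K : Type v} [CommRing R] [Field K]
    [Algebra R K] {I : FractionalIdeal R⁰ K} (hI : I ∈ traceIdeals R K) : I ≤ 1 := by
  obtain ⟨-, a, -, rfl⟩ := hI
  exact coeIdeal_le_one

variable {R : Type u} {K : Type v} [CommRing R] [IsDomain R] [Field K] [Algebra R K]
  [IsFractionRing R K] {I : FractionalIdeal R⁰ K}

theorem mul_inv_le_of_isTraceIdeal {a : Ideal R} (ha : IsTraceIdeal a) :
    (a : FractionalIdeal R⁰ K) * (a : FractionalIdeal R⁰ K)⁻¹ ≤ a := by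
  rcases eq_or_ne a ⊥ with rfl | h0
  · simp
  obtain ⟨M, _, _, -, rfl⟩ := ha
  refine FractionalIdeal.mul_le.mpr fun y hy q hq => ?_
  have hq := (mem_inv_iff (coeIdeal_ne_zero.mpr h0)).mp hq
  obtain ⟨u, hu, rfl⟩ := (mem_coeIdeal R⁰).mp hy
  clear hy
  induction hu using Submodule.iSup_induction' with
  | mem φ u hφ =>
    obtain ⟨m, rfl⟩ := hφ
    have hmem (m' : M) : q * algebraMap R K (φ m') ∈ LinearMap.range (Algebra.linearMap R K) :=
      (mem_one_iff R⁰).mp (hq _ (mem_coeIdeal_of_mem R⁰ (Submodule.mem_iSup_of_mem φ ⟨m', rfl⟩)))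
    let ψ : M →ₗ[R] R := LinearMap.codRestrictOfInjective
      (LinearMap.mulLeft R q ∘ₗ Algebra.linearMap R K ∘ₗ φ) (Algebra.linearMap R K)
      (IsFractionRing.injective R K) hmem
    have hψ : algebraMap R K (ψ m) = q * algebraMap R K (φ m) :=
      LinearMap.codRestrictOfInjective_comp_apply _ (Algebra.linearMap R K) _ hmem m
    rw [mul_comm, ← hψ]
    exact mem_coeIdeal_of_mem R⁰ (Submodule.mem_iSup_of_mem ψ ⟨m, rfl⟩)
  | zero => simp
  | add u w hu hw hu' hw' =>
    rw [map_add, add_mul]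
    exact add_mem (S := Submodule R K) hu' hw'

theorem isTraceIdeal_of_mul_inv_le [IsNoetherianRing R] {a : Ideal R} (ha : a ≠ ⊥)
    (h : (a : FractionalIdeal R⁰ K) * (a : FractionalIdeal R⁰ K)⁻¹ ≤ a) : IsTraceIdeal a := by
  refine ⟨a, inferInstance, inferInstance, inferInstance, le_antisymm ?_ (iSup_le fun φ => ?_)⟩
  · exact le_iSup_of_le a.subtype a.range_subtype.ge
  rintro _ ⟨w, rfl⟩
  obtain ⟨q, hq⟩ := exists_eq_mul_of_linearMap K ha φ
  have hqa : q ∈ (a : FractionalIdeal R⁰ K)⁻¹ := by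
    rw [mem_inv_iff (coeIdeal_ne_zero.mpr ha)]
    intro y hy
    obtain ⟨u, hu, rfl⟩ := (mem_coeIdeal R⁰).mp hy
    exact (mem_one_iff R⁰).mpr ⟨_, hq ⟨u, hu⟩⟩
  have hφw := h (mul_mem_mul (mem_coeIdeal_of_mem R⁰ w.2) hqa)
  rw [mul_comm, ← hq] at hφw
  obtain ⟨r, hr, hr'⟩ := (mem_coeIdeal R⁰).mp hφw
  rwa [← IsFractionRing.injective R K hr']

theorem mul_inv_of_mem_traceIdeals (hI : I ∈ traceIdeals R K) : I * I⁻¹ = I := by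
  refine le_antisymm ?_ (le_self_mul_inv (le_one_of_mem_traceIdeals hI))
  obtain ⟨-, a, ha, rfl⟩ := hI
  exact mul_inv_le_of_isTraceIdeal ha

theorem mem_traceIdeals_iff [IsNoetherianRing R] :
    I ∈ traceIdeals R K ↔ I ≠ 0 ∧ I * I⁻¹ = I := by
  refine ⟨fun hI => ⟨hI.1, mul_inv_of_mem_traceIdeals hI⟩, fun ⟨h0, h⟩ => ⟨h0, ?_⟩⟩
  obtain ⟨a, rfl⟩ := le_one_iff_exists_coeIdeal.mp (h.symm.trans_le
    (fractionalIdeal_mul_inv_le_one I))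
  exact ⟨a, isTraceIdeal_of_mul_inv_le (coeIdeal_ne_zero.mp h0) h.le, rfl⟩

theorem one_le_inv_of_mem_traceIdeals (hI : I ∈ traceIdeals R K) : 1 ≤ I⁻¹ := by
  rw [fractionalIdeal_le_inv_iff hI.1, one_mul]
  exact le_one_of_mem_traceIdeals hI

theorem inv_mul_inv_of_mem_traceIdeals (hI : I ∈ traceIdeals R K) : I⁻¹ * I⁻¹ = I⁻¹ := by
  refine le_antisymm ?_ (le_mul_of_one_le_right' (one_le_inv_of_mem_traceIdeals hI))
  rw [fractionalIdeal_le_inv_iff hI.1, mul_assoc, mul_comm I⁻¹ I, mul_inv_of_mem_traceIdeals hI,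
    mul_comm]
  exact fractionalIdeal_mul_inv_le_one I

theorem inv_mem_traceIdeals [IsNoetherianRing R] (hI : 1 ≤ I) (hII : I * I = I) :
    I⁻¹ ∈ traceIdeals R K := by
  have hI0 := fractionalIdeal_ne_zero_of_one_le hI
  have hinv0 := fractionalIdeal_inv_ne_zero hI0
  refine mem_traceIdeals_iff.mpr ⟨hinv0, le_antisymm ?_
    (le_self_mul_inv (fractionalIdeal_inv_le_one hI))⟩
  have hle : I⁻¹ * I ≤ I⁻¹ := by
    rw [fractionalIdeal_le_inv_iff hI0, mul_assoc, hII, mul_comm]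
    exact fractionalIdeal_mul_inv_le_one I
  rw [fractionalIdeal_le_inv_iff hI0, mul_right_comm]
  exact (mul_le_mul_left hle _).trans (fractionalIdeal_mul_inv_le_one _)

theorem inv_inv_of_isGorensteinLocal [IsLocalRing R] [IsNoetherianRing R] [Ring.KrullDimLE 1 R]
    (hG : IsGorensteinLocal R) (hI : I ∈ traceIdeals R K) : I⁻¹⁻¹ = I := by
  obtain ⟨h0, a, -, rfl⟩ := hI
  exact coeIdeal_inv_inv_of_isGorensteinLocal hG (coeIdeal_ne_zero.mp h0)

end TraceIdeals

section StarMul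

theorem eq_subtr_of_isGreatest {R : Type u} {K : Type v} [CommRing R] [Field K]
    [Algebra R K] [IsFractionRing R K] {I L : FractionalIdeal R⁰ K}
    (h : IsGreatest {L | L ∈ traceIdeals R K ∧ L ≤ I} L) : L = subtr I := by
  obtain ⟨⟨⟨-, a, ha, rfl⟩, haI⟩, hmax⟩ := h
  refine congrArg _ (le_antisymm (le_sSup ⟨ha, haI⟩) (sSup_le fun b hb => ?_))
  rcases eq_or_ne b ⊥ with rfl | hb0
  · exact bot_le
  · exact (coeIdeal_le_coeIdeal K).mp
      (hmax ⟨⟨coeIdeal_ne_zero.mpr hb0, b, hb.1, rfl⟩, hb.2⟩)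

variable {R : Type u} {K : Type v} [CommRing R] [IsDomain R] [Field K] [Algebra R K]
  [IsFractionRing R K] {I J L : FractionalIdeal R⁰ K}

theorem starMul_comm (I J : FractionalIdeal R⁰ K) : starMul I J = starMul J I := by
  rw [starMul, mul_comm, starMul]

theorem one_starMul (I : FractionalIdeal R⁰ K) : starMul 1 I = I⁻¹⁻¹ := by
  rw [starMul, FractionalIdeal.inv_eq (I := 1), FractionalIdeal.div_one, one_mul]

theorem starMul_self_of_mem_traceIdeals (hI : I ∈ traceIdeals R K) : starMul I I = I⁻¹⁻¹ := by
  rw [starMul, inv_mul_inv_of_mem_traceIdeals hI]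

theorem starMul_mem_traceIdeals [IsNoetherianRing R] (hI : I ∈ traceIdeals R K)
    (hJ : J ∈ traceIdeals R K) : starMul I J ∈ traceIdeals R K := by
  refine inv_mem_traceIdeals
    (one_le_mul (one_le_inv_of_mem_traceIdeals hI) (one_le_inv_of_mem_traceIdeals hJ)) ?_
  rw [mul_mul_mul_comm, inv_mul_inv_of_mem_traceIdeals hI, inv_mul_inv_of_mem_traceIdeals hJ]

theorem starMul_le_inv_inv (hI : I ≠ 0) (hJ : J ∈ traceIdeals R K) : starMul I J ≤ I⁻¹⁻¹ :=
  have hle : I⁻¹ ≤ I⁻¹ * J⁻¹ := le_mul_of_one_le_right' (one_le_inv_of_mem_traceIdeals hJ)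
  inv_anti_mono (fractionalIdeal_inv_ne_zero hI)
    ((bot_lt_iff_ne_bot.mpr (fractionalIdeal_inv_ne_zero hI)).trans_le hle).ne' hle

theorem le_starMul (hL : L ∈ traceIdeals R K) (hI : I ∈ traceIdeals R K)
    (hJ : J ∈ traceIdeals R K) (hLI : L ≤ I) (hLJ : L ≤ J) : L ≤ starMul I J := by
  have hle : I⁻¹ * J⁻¹ ≤ L⁻¹ := (mul_le_mul' (inv_anti_mono hL.1 hI.1 hLI)
    (inv_anti_mono hL.1 hJ.1 hLJ)).trans_eq (inv_mul_inv_of_mem_traceIdeals hL)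
  exact (fractionalIdeal_le_inv_inv hL.1).trans <|
    inv_anti_mono (fractionalIdeal_ne_zero_of_one_le
      (one_le_mul (one_le_inv_of_mem_traceIdeals hI) (one_le_inv_of_mem_traceIdeals hJ)))
      (fractionalIdeal_inv_ne_zero hL.1) hle

theorem isGreatest_starMul [IsNoetherianRing R] (hI : I ∈ traceIdeals R K)
    (hJ : J ∈ traceIdeals R K) (hII : I⁻¹⁻¹ = I) (hJJ : J⁻¹⁻¹ = J) :
    IsGreatest {L | L ∈ traceIdeals R K ∧ L ≤ I ⊓ J} (starMul I J) := by
  refine ⟨⟨starMul_mem_traceIdeals hI hJ, le_inf ?_ ?_⟩, fun L ⟨hL, hLIJ⟩ =>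
    le_starMul hL hI hJ (hLIJ.trans inf_le_left) (hLIJ.trans inf_le_right)⟩
  · exact (starMul_le_inv_inv hI.1 hJ).trans_eq hII
  · rw [starMul_comm]
    exact (starMul_le_inv_inv hJ.1 hI).trans_eq hJJ

end StarMul

section Conductor

section

variable (R K : Type*) [CommRing R] [Field K] [Algebra R K] [IsFractionRing R K]
  [Module.Finite R (integralClosure R K)]

/-- The integral closure of `R` in its quotient field `K` as a fractional ideal of `R`, available
when it is a finite `R`-module. The conductor is its inverse. -/
noncomputable def integralClosureIdeal : FractionalIdeal R⁰ K :=
  ⟨Subalgebra.toSubmodule (integralClosure R K),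
    isFractional_of_fg (Module.Finite.iff_fg.mp ‹_›)⟩

theorem one_le_integralClosureIdeal : 1 ≤ integralClosureIdeal R K := fun x hx => by
  obtain ⟨r, rfl⟩ := (mem_one_iff R⁰).mp hx
  exact (integralClosure R K).algebraMap_mem r

theorem integralClosureIdeal_mul_self :
    integralClosureIdeal R K * integralClosureIdeal R K = integralClosureIdeal R K :=
  le_antisymm (FractionalIdeal.mul_le.mpr fun _ hx _ hy => (integralClosure R K).mul_mem hx hy)
    (le_mul_of_one_le_right' (one_le_integralClosureIdeal R K))

end

variable {R : Type u} {K : Type v} [CommRing R] [IsDomain R] [Field K] [Algebra R K]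
  [IsFractionRing R K] {I : FractionalIdeal R⁰ K}

theorem isIntegral_of_mem_inv [IsNoetherianRing R] (hI : I ∈ traceIdeals R K) {x : K}
    (hx : x ∈ I⁻¹) : IsIntegral R x := by
  refine isIntegral_of_smul_mem_submodule (I : Submodule R K) (mt coeToSubmodule_eq_bot.mp hI.1)
    (isNoetherian_submodule.mp (FractionalIdeal.isNoetherian I) _ le_rfl) x fun y hy => ?_
  have hyx : y * x ∈ I * I⁻¹ := mul_mem_mul hy hx
  rwa [mul_inv_of_mem_traceIdeals hI, mul_comm] at hyx

variable (R K) in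
theorem conductorIdeal_eq_inv [Module.Finite R (integralClosure R K)] :
    conductorIdeal R K = (integralClosureIdeal R K)⁻¹ := by
  refine coeToSubmodule_injective ?_
  change _ = ((1 / integralClosureIdeal R K : FractionalIdeal R⁰ K) : Submodule R K)
  rw [coe_div (fractionalIdeal_ne_zero_of_one_le (one_le_integralClosureIdeal R K)), coe_one]
  rfl

theorem starMul_conductorIdeal [IsNoetherianRing R] [Module.Finite R (integralClosure R K)]
    (hI : I ∈ traceIdeals R K) : starMul I (conductorIdeal R K) = conductorIdeal R K := by
  have hone := one_le_integralClosureIdeal R K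
  have hne := fractionalIdeal_ne_zero_of_one_le hone
  have hC : conductorIdeal R K ∈ traceIdeals R K :=
    conductorIdeal_eq_inv R K ▸ inv_mem_traceIdeals hone (integralClosureIdeal_mul_self R K)
  have hle : I⁻¹ ≤ (conductorIdeal R K)⁻¹ := by
    rw [conductorIdeal_eq_inv]
    exact le_trans (fun x hx => isIntegral_of_mem_inv hI hx) (fractionalIdeal_le_inv_inv hne)
  have hmul : I⁻¹ * (conductorIdeal R K)⁻¹ = (conductorIdeal R K)⁻¹ :=
    le_antisymm ((mul_le_mul_left hle _).trans_eq (inv_mul_inv_of_mem_traceIdeals hC))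
      (le_mul_of_one_le_left' (one_le_inv_of_mem_traceIdeals hI))
  rw [starMul, hmul, conductorIdeal_eq_inv, fractionalIdeal_inv_inv_inv hne]

end Conductor

theorem mainTheorem8_general (R : Type u) (K : Type v) [CommRing R] [IsDomain R]
    [IsNoetherianRing R] [Field K] [Algebra R K] [IsFractionRing R K]
    [Module.Finite R (integralClosure R K)] (I J : FractionalIdeal R⁰ K)
    (hI : I ∈ traceIdeals R K) (hJ : J ∈ traceIdeals R K) (hII : I⁻¹⁻¹ = I) (hJJ : J⁻¹⁻¹ = J) :
    starMul I J ∈ traceIdeals R K ∧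
    (starMul I J = starMul J I ∧ starMul 1 I = I ∧ starMul I I = I ∧
      starMul I (conductorIdeal R K) = conductorIdeal R K) ∧
    (starMul I J = subtr (I ⊓ J) ∧
      IsGreatest {L | L ∈ traceIdeals R K ∧ L ≤ I ⊓ J} (starMul I J) ∧
      starMul I J ≤ I ⊓ J ∧
      (I ⊓ J ∈ traceIdeals R K ↔ I ⊓ J = starMul I J)) := by
  have hgreatest := isGreatest_starMul hI hJ hII hJJ
  exact ⟨starMul_mem_traceIdeals hI hJ,
    ⟨starMul_comm I J, (one_starMul I).trans hII, (starMul_self_of_mem_traceIdeals hI).trans hII,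
      starMul_conductorIdeal hI⟩,
    eq_subtr_of_isGreatest hgreatest, hgreatest, hgreatest.1.2,
    fun h => le_antisymm (hgreatest.2 ⟨h, le_rfl⟩) hgreatest.1.2, fun h => h ▸ hgreatest.1.1⟩

theorem mainTheorem8 (R : Type u) (K : Type v) [CommRing R] [IsDomain R] [IsLocalRing R]
    [IsNoetherianRing R] [Field K] [Algebra R K] [IsFractionRing R K]
    (hR : IsOneDimAnalyticallyIrreducible R K) (hG : IsGorensteinLocal R)
    (I J : FractionalIdeal R⁰ K) (hI : I ∈ traceIdeals R K) (hJ : J ∈ traceIdeals R K) :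
    starMul I J ∈ traceIdeals R K ∧
    (starMul I J = starMul J I ∧ starMul 1 I = I ∧ starMul I I = I ∧
      starMul I (conductorIdeal R K) = conductorIdeal R K) ∧
    (starMul I J = subtr (I ⊓ J) ∧
      IsGreatest {L | L ∈ traceIdeals R K ∧ L ≤ I ⊓ J} (starMul I J) ∧
      starMul I J ≤ I ⊓ J ∧
      (I ⊓ J ∈ traceIdeals R K ↔ I ⊓ J = starMul I J)) := by
  have : Ring.KrullDimLE 1 R := Ring.krullDimLE_iff.mpr hR.dim_eq_one.le
  have : Module.Finite R (integralClosure R K) := hR.integralClosure_finite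
  exact mainTheorem8_general R K I J hI hJ (inv_inv_of_isGorensteinLocal hG hI)
    (inv_inv_of_isGorensteinLocal hG hJ)
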